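/- Let $n\ge 1$ be an integer, let $0<p\le 1$ and $\nu\ge 1$ be real, and let $Y$ have the Conway–Maxwell–binomial distribution $\mathrm{CMB}(n,p,\nu)$, that is, $$\mathbb P(Y=j)=\frac{1}{C_n}\binom nj^{\nu}p^j(1-p)^{n-j}\quad(0\le j\le n),\qquad C_n=\sum_{i=0}^n\binom ni^{\nu}p^i(1-p)^{n-i}.$$ Let $\mu=\mathbb EY$ and let $\mathrm{Po}(\mu)$ be the Poisson distribution with mean $\mu$. For laws on $\mathbb Z^+=\{0,1,2,\dots\}$ let $d_{TV}(\mathcal L(U),\mathcal L(V))=\sup_{A\subseteq\mathbb Z^+}|\mathbb P(U\in A)-\mathbb P(V\in A)|$. Let $$R_Y=\sup_g \frac{\mathbb E[g(Y)^2]}{\mathbb E[\{g(Y+1)-g(Y)\}^2]},$$ where the supremum is over all $g:\mathbb Z^+\to\mathbb R$ with $\mathbb E[g(Y)^2]<\infty$ and $\mathbb E\,g(Y)=0$ (a ratio $0/0$ is read as $0$). Write $U\le_{st}V$ if $\mathbb Ef(U)\le\mathbb Ef(V)$ for all increasing $f$ for which the expectations exist, and, when $\mathbb EU=\mathbb EV$,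 write $U\le_{cx}V$ if $\mathbb Ef(U)\le\mathbb Ef(V)$ for all convex $f$ (expectations in $(-\infty,\infty]$). For $\alpha>0$ let $Y^{(\alpha)}$ have the $\alpha$-power-biased distribution of $Y$, $\mathbb P(Y^{(\alpha)}=j)=j^{\alpha}\,\mathbb P(Y=j)/\mathbb E[Y^{\alpha}]$. Then: (i) $\displaystyle d_{TV}(\mathcal L(Y),\mathrm{Po}(\mu))\le\frac1\mu\bigl(\mu-\mathrm{Var}(Y)\bigr)$. (ii) $\mathrm{Var}(Y)\le R_Y\le\mu$. (iii) $Y\le_{cx}X$, where $X\sim\mathrm{Po}(\mu)$; moreover, for all real $t\ge 0$, $$\mathbb P(Y\ge\mu+t)\le e^{t}\Bigl(1+\frac t\mu\Bigr)^{-(\mu+t)},$$ and, for all real $0\le t<\mu$, $$\mathbb P(Y\le\mu-t)\le e^{-t}\Bigl(1-\frac t\mu\Bigr)^{t-\mu}.$$ (iv) $Y^{(1)}\le_{st}Y^{(\nu)}\le_{st}Y+1$. -/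

import Mathlib

open MeasureTheory ProbabilityTheory
open scoped NNReal ENNReal

namespace CMB

noncomputable section

/-- The normalizing constant `C_n = ∑_{i ≤ n} (n choose i)^ν p^i (1-p)^(n-i)`. -/
def normalizer (n : ℕ) (p ν : ℝ) : ℝ :=
  ∑ i ∈ Finset.range (n + 1), (n.choose i : ℝ) ^ ν * p ^ i * (1 - p) ^ (n - i)

/-- The mass function of the Conway-Maxwell-binomial distribution `CMB(n, p, ν)`,
extended by zero outside `{0, …, n}`. -/
def pmfReal (n : ℕ) (p ν : ℝ) (j : ℕ) : ℝ :=
  if j ≤ n then (n.choose j : ℝ) ^ ν * p ^ j * (1 - p) ^ (n - j) / normalizer n p ν else 0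

/-- The Conway-Maxwell-binomial distribution `CMB(n, p, ν)`, as a measure on `ℕ`. -/
def cmbMeasure (n : ℕ) (p ν : ℝ) : Measure ℕ :=
  Measure.sum fun j => ENNReal.ofReal (pmfReal n p ν j) • Measure.dirac j

/-- Total variation distance of two laws on `ℕ`: the supremum over all `A ⊆ ℕ` of
`|P(U ∈ A) - P(V ∈ A)|` (bounded by `1` for probability measures). -/
def dTV (P Q : Measure ℕ) : ℝ :=
  ⨆ A : Set ℕ, |P.real A - Q.real A|

/-- The class of `g : ℕ → ℝ` with `E[g(U)²] < ∞` and `E[g(U)] = 0`, where `U` has law `P`. -/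
def centred (P : Measure ℕ) : Set (ℕ → ℝ) :=
  {g | MemLp g 2 P ∧ ∫ k, g k ∂P = 0}

/-- The Poincaré (inverse spectral gap) constant of a law `P` on `ℕ`: the supremum of
`E[g(U)²] / E[(g(U+1) - g(U))²]` over all `g` with `E[g(U)²] < ∞` and `E[g(U)] = 0`.
It takes values in `[0, ∞]`; there `a / 0 = ∞` for `a ≠ 0`, and the ratio `0 / 0` is `0`, so that
functions with `g(U) = 0` almost surely do not contribute. -/
def poincareConst (P : Measure ℕ) : ℝ≥0∞ :=
  ⨆ g ∈ centred P,
    (∫⁻ k, ENNReal.ofReal (g k ^ 2) ∂P) / (∫⁻ k, ENNReal.ofReal ((g (k + 1) - g k) ^ 2) ∂P)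

/-- The `ν`-power-biased law of a law `P` on `ℕ`:
its mass at `j` is `j^ν P({j}) / E[W^ν]`, where `W` has law `P`. -/
def powerBias (ν : ℝ) (P : Measure ℕ) : Measure ℕ :=
  P.withDensity fun j => ENNReal.ofReal ((j : ℝ) ^ ν / ∫ k, (k : ℝ) ^ ν ∂P)

/-- The usual stochastic order of laws on `ℕ`: `E[f(U)] ≤ E[f(V)]` for all increasing functions
`f` for which both expectations are finite. -/
def StLE (P Q : Measure ℕ) : Prop :=
  ∀ f : ℝ → ℝ, Monotone f → Integrable (fun k : ℕ => f k) P → Integrable (fun k : ℕ => f k) Q →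
    ∫ k, f k ∂P ≤ ∫ k, f k ∂Q

/-- The convex order of laws on `ℕ`: the means exist and agree, and `E[f(U)] ≤ E[f(V)]` for all
convex functions `f`. For laws with finite mean these expectations always exist in `(-∞, ∞]`, so
the inequality says that if `E[f(V)]` is finite then so is `E[f(U)]`, and it is at most
`E[f(V)]`. -/
def CxLE (P Q : Measure ℕ) : Prop :=
  Integrable (fun k : ℕ => (k : ℝ)) P ∧ Integrable (fun k : ℕ => (k : ℝ)) Q ∧
    ∫ k, (k : ℝ) ∂P = ∫ k, (k : ℝ) ∂Q ∧
    ∀ f : ℝ → ℝ, ConvexOn ℝ Set.univ f → Integrable (fun k : ℕ => f k) Q →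
      Integrable (fun k : ℕ => f k) P ∧ ∫ k, f k ∂P ≤ ∫ k, f k ∂Q

end

end CMB

/-! Everything rests on a monotone ratio. Where the masses are positive, `(j+1)^ν w(j+1) / w(j)` is
`(n-j)^ν p/(1-p)`, decreasing in `j`; the factor `(j+1)^(1-ν)` is decreasing since `ν ≥ 1`, so
`(j+1) w(j+1) / w(j)` decreases too (`UltraLogConcave`). All ratios are cross-multiplied, so `p = 1`
and vanishing masses need no separate treatment.

A monotone likelihood ratio gives stochastic order, hence E[Y f(Y)] ≤ m E[f(Y+1)] for increasing
`f`, with m = E Y (`sum_sizeBias_le`). Taking f = x/m ± g, with `g` a Stein-Chen solution whose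
increments are at most 1/m, bounds the total variation distance. Taking indicators 1{j < x} bounds
the weights Cov(Y, 1{Y > j}) in Cacoullos' inequality by m w(j), which is the Poincaré inequality.
The same likelihood ratio argument with powers `ν` orders the power-biased laws.

The ratio of `w` to a Poisson mass is log-concave, so `w` exceeds it on an interval. Subtracting a
chord from a convex function then gives convex order, and its exponential case gives the tails by
Chernoff's bound. -/

namespace CMB

/-! ### Likelihood ratios, size bias and the Poincaré inequality -/

/-- Likelihood ratio domination implies stochastic domination, for unnormalized weights. -/
theorem sum_mul_sum_le_of_likelihoodRatio (s : Finset ℕ) (a b f : ℕ → ℝ) (hf : Monotone f)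
    (h : ∀ i j, i ≤ j → a j * b i ≤ a i * b j) :
    (∑ i ∈ s, a i * f i) * ∑ j ∈ s, b j ≤ (∑ i ∈ s, b i * f i) * ∑ j ∈ s, a j := by
  -- Chebyshev's symmetrization: both factors change sign with the order of `i` and `j`, and the
  -- double sum is twice the desired difference.
  have key : 0 ≤ ∑ i ∈ s, ∑ j ∈ s, (f j - f i) * (a i * b j - a j * b i) := by
    refine Finset.sum_nonneg fun i _ => Finset.sum_nonneg fun j _ => ?_
    rcases le_total i j with hij | hij
    · exact mul_nonneg (sub_nonneg.2 (hf hij)) (sub_nonneg.2 (h i j hij))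
    · exact mul_nonneg_of_nonpos_of_nonpos (sub_nonpos.2 (hf hij)) (sub_nonpos.2 (h j i hij))
  have e : ∑ i ∈ s, ∑ j ∈ s, (f j - f i) * (a i * b j - a j * b i)
      = 2 * ((∑ i ∈ s, b i * f i) * ∑ j ∈ s, a j - (∑ i ∈ s, a i * f i) * ∑ j ∈ s, b j) := by
    have e1 : ∀ u v : ℕ → ℝ, ∑ i ∈ s, ∑ j ∈ s, u i * v j = (∑ i ∈ s, u i) * ∑ j ∈ s, v j :=
      fun u v => (Finset.sum_mul_sum s s u v).symm
    calc _ = ∑ i ∈ s, ∑ j ∈ s, (a i * (b j * f j) - b i * (a j * f j) - (a i * f i) * b j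
          + (b i * f i) * a j) := by
          refine Finset.sum_congr rfl fun i _ => Finset.sum_congr rfl fun j _ => ?_
          ring
      _ = _ := by
          simp only [Finset.sum_add_distrib, Finset.sum_sub_distrib]
          rw [e1 a fun j => b j * f j, e1 b fun j => a j * f j, e1 (fun i => a i * f i) b,
            e1 (fun i => b i * f i) a]
          ring
  linarith

/-- A probability mass function on `{0, …, N}` that is log-concave relative to the Poisson
distribution. -/
structure UltraLogConcave (N : ℕ) (w : ℕ → ℝ) : Prop where
  nonneg : ∀ j, 0 ≤ w j
  eq_zero : ∀ j, N < j → w j = 0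
  sum_eq_one : ∑ j ∈ Finset.range (N + 1), w j = 1
  ratio : ∀ i j : ℕ, i ≤ j → ((j : ℝ) + 1) * w (j + 1) * w i ≤ ((i : ℝ) + 1) * w (i + 1) * w j

namespace UltraLogConcave

variable {N : ℕ} {w : ℕ → ℝ}

theorem sum_shift (h : UltraLogConcave N w) (f : ℕ → ℝ) :
    ∑ j ∈ Finset.range (N + 1), ((j : ℝ) + 1) * w (j + 1) * f (j + 1)
      = ∑ j ∈ Finset.range (N + 1), w j * (j * f j) := by
  have h1 := Finset.sum_range_succ (fun j : ℕ => w j * (j * f j)) (N + 1)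
  have h2 := Finset.sum_range_succ' (fun j : ℕ => w j * (j * f j)) (N + 1)
  rw [h1, h.eq_zero (N + 1) (by omega)] at h2
  simp only [zero_mul, add_zero, Nat.cast_zero, mul_zero] at h2
  rw [h2]
  refine Finset.sum_congr rfl fun j _ => ?_
  push_cast
  ring

/-- The size-biased law is stochastically dominated by the law shifted by one. -/
theorem sum_sizeBias_le (h : UltraLogConcave N w) {f : ℕ → ℝ} (hf : Monotone f) :
    ∑ j ∈ Finset.range (N + 1), w j * (j * f j)
      ≤ (∑ j ∈ Finset.range (N + 1), w j * j) * ∑ j ∈ Finset.range (N + 1), w j * f (j + 1) := by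
  have h1 := sum_mul_sum_le_of_likelihoodRatio (Finset.range (N + 1))
    (fun j => ((j : ℝ) + 1) * w (j + 1)) w (fun j => f (j + 1))
    (fun i j hij => hf (by omega)) h.ratio
  have h2 := h.sum_shift fun _ => 1
  simp only [mul_one] at h2
  rw [h.sum_shift f, h.sum_eq_one, h2] at h1
  linarith

/-- Cacoullos' bound for a discrete increment. -/
theorem sq_sub_le_sum_sq (g : ℕ → ℝ) {x y : ℕ} (hx : x ≤ N + 1) (hy : y ≤ N + 1) :
    (g y - g x) ^ 2 ≤ ∑ j ∈ Finset.range (N + 1), ((y : ℝ) - x) *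
      ((if j < y then 1 else 0) - (if j < x then 1 else 0)) * (g (j + 1) - g j) ^ 2 := by
  -- The signed weight is symmetric in `x` and `y` and a sum of products of one-variable functions,
  -- so it can be averaged over an independent pair without ordering it. What remains is
  -- Cauchy-Schwarz on `[x, y)`.
  wlog hxy : x ≤ y generalizing x y
  · refine (le_of_eq (by ring)).trans ((this hy hx (by omega)).trans (le_of_eq ?_))
    refine Finset.sum_congr rfl fun j _ => ?_
    ring
  have h1 := sq_sum_le_card_mul_sum_sq (s := Finset.Ico x y) (f := fun j => g (j + 1) - g j)
  rw [Finset.sum_Ico_sub g hxy, Nat.card_Ico, Nat.cast_sub hxy] at h1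
  refine h1.trans (le_of_eq ?_)
  have h2 : Finset.Ico x y = (Finset.range (N + 1)).filter (fun j => x ≤ j ∧ j < y) := by
    ext j; simp only [Finset.mem_Ico, Finset.mem_filter, Finset.mem_range]; omega
  rw [h2, Finset.sum_filter, Finset.mul_sum]
  refine Finset.sum_congr rfl fun j _ => ?_
  by_cases h3 : j < x
  · have h4 : j < y := by omega
    simp [h3, h4, not_le.2 h3]
  · by_cases h4 : j < y <;> simp [h3, h4, not_lt.1 h3]

/-- Poincaré inequality with constant the mean. -/
theorem sum_sq_le (h : UltraLogConcave N w) (g : ℕ → ℝ)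
    (hg : ∑ j ∈ Finset.range (N + 1), w j * g j = 0) :
    ∑ j ∈ Finset.range (N + 1), w j * g j ^ 2
      ≤ (∑ j ∈ Finset.range (N + 1), w j * j) *
        ∑ j ∈ Finset.range (N + 1), w j * (g (j + 1) - g j) ^ 2 := by
  set s := Finset.range (N + 1) with hs
  set m := ∑ j ∈ s, w j * j with hm
  have hL : ∑ x ∈ s, ∑ y ∈ s, w x * w y * (g y - g x) ^ 2 = 2 * ∑ j ∈ s, w j * g j ^ 2 := by
    calc _ = ∑ x ∈ s, ∑ y ∈ s, (w x * (w y * g y ^ 2) - 2 * ((w x * g x) * (w y * g y))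
          + (w x * g x ^ 2) * w y) := by
          refine Finset.sum_congr rfl fun i _ => Finset.sum_congr rfl fun j _ => ?_
          ring
      _ = _ := by
          simp only [Finset.sum_add_distrib, Finset.sum_sub_distrib, ← Finset.mul_sum]
          simp only [← Finset.sum_mul]
          rw [h.sum_eq_one, hg]
          ring
  -- The left side is 2 Cov(Y, 1{Y > j}); the size-bias inequality for the indicator bounds it,
  -- since P(Y + 1 > j) - P(Y > j) = w j.
  have hR : ∀ j ∈ s, ∑ x ∈ s, ∑ y ∈ s, w x * w y * (((y : ℝ) - x) *
      ((if j < y then 1 else 0) - (if j < x then 1 else 0))) ≤ 2 * (m * w j) := by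
    intro j hj
    have hmono : Monotone fun k : ℕ => if j < k then (1 : ℝ) else 0 := by
      intro a b hab
      dsimp only
      split_ifs <;> first | omega | norm_num
    have h1 := h.sum_sizeBias_le hmono
    rw [← hs, ← hm] at h1
    have h2 : ∑ k ∈ s, w k * (if j < k + 1 then (1 : ℝ) else 0)
        = w j + ∑ k ∈ s, w k * (if j < k then (1 : ℝ) else 0) := by
      rw [← Finset.sum_ite_eq_of_mem' s j w hj, ← Finset.sum_add_distrib]
      refine Finset.sum_congr rfl fun k _ => ?_
      rcases lt_trichotomy j k with h3 | h3 | h3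
      · simp [h3, h3.ne', Nat.lt_succ_of_lt h3]
      · simp [h3]
      · have : ¬ j < k + 1 := by omega
        simp [h3.ne, h3.le, this]
    rw [h2] at h1
    calc _ = ∑ x ∈ s, ∑ y ∈ s, (w x * (w y * (y * if j < y then 1 else 0))
          - (w x * x) * (w y * if j < y then 1 else 0)
          - (w x * if j < x then 1 else 0) * (w y * y)
          + (w x * (x * if j < x then 1 else 0)) * w y) := by
          refine Finset.sum_congr rfl fun i _ => Finset.sum_congr rfl fun k _ => ?_
          ring
      _ = 2 * (∑ k ∈ s, w k * (k * if j < k then 1 else 0)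
          - m * ∑ k ∈ s, w k * if j < k then 1 else 0) := by
          simp only [Finset.sum_add_distrib, Finset.sum_sub_distrib, ← Finset.mul_sum]
          simp only [← Finset.sum_mul]
          rw [h.sum_eq_one, ← hm]
          ring
      _ ≤ _ := by linarith
  have hlow : ∑ x ∈ s, ∑ y ∈ s, w x * w y * (g y - g x) ^ 2 ≤
      ∑ x ∈ s, ∑ y ∈ s, ∑ j ∈ s, w x * w y * (((y : ℝ) - x) *
      ((if j < y then 1 else 0) - (if j < x then 1 else 0))) * (g (j + 1) - g j) ^ 2 := by
    refine Finset.sum_le_sum fun x hx => Finset.sum_le_sum fun y hy => ?_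
    have h3 := mul_le_mul_of_nonneg_left (sq_sub_le_sum_sq (N := N) g
      (Finset.mem_range.1 hx).le (Finset.mem_range.1 hy).le)
      (mul_nonneg (h.nonneg x) (h.nonneg y))
    rw [Finset.mul_sum] at h3
    refine h3.trans (le_of_eq (Finset.sum_congr rfl fun j _ => ?_))
    ring
  have hswap : ∑ x ∈ s, ∑ y ∈ s, ∑ j ∈ s, w x * w y * (((y : ℝ) - x) *
      ((if j < y then 1 else 0) - (if j < x then 1 else 0))) * (g (j + 1) - g j) ^ 2
      = ∑ j ∈ s, (∑ x ∈ s, ∑ y ∈ s, w x * w y * (((y : ℝ) - x) *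
      ((if j < y then 1 else 0) - (if j < x then 1 else 0)))) * (g (j + 1) - g j) ^ 2 := by
    simp only [Finset.sum_mul]
    rw [Finset.sum_comm]
    rw [Finset.sum_comm' (t' := s) (s' := fun _ => s) (by simp)]
    conv_rhs => rw [Finset.sum_comm]
    refine Finset.sum_congr rfl fun x _ => ?_
    rw [Finset.sum_comm]
  have hfin : ∑ j ∈ s, (∑ x ∈ s, ∑ y ∈ s, w x * w y * (((y : ℝ) - x) *
      ((if j < y then 1 else 0) - (if j < x then 1 else 0)))) * (g (j + 1) - g j) ^ 2
      ≤ ∑ j ∈ s, 2 * (m * (w j * (g (j + 1) - g j) ^ 2)) := by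
    refine Finset.sum_le_sum fun j hj => ?_
    have := mul_le_mul_of_nonneg_right (hR j hj) (sq_nonneg (g (j + 1) - g j))
    linarith
  rw [← Finset.mul_sum, ← Finset.mul_sum] at hfin
  linarith

end UltraLogConcave

/-! ### The Poisson law and the Stein-Chen equation -/

/-- The Poisson mass function with real parameter. -/
noncomputable def poissonMass (r : ℝ) (j : ℕ) : ℝ := Real.exp (-r) * r ^ j / (j.factorial : ℝ)

theorem poissonMass_pos {r : ℝ} (hr : 0 < r) (j : ℕ) : 0 < poissonMass r j := by
  unfold poissonMass
  positivity

theorem succ_mul_poissonMass_succ (r : ℝ) (j : ℕ) :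
    ((j : ℝ) + 1) * poissonMass r (j + 1) = r * poissonMass r j := by
  unfold poissonMass
  have : (j.factorial : ℝ) ≠ 0 := by positivity
  rw [Nat.factorial_succ]
  push_cast
  field_simp
  ring

theorem hasSum_poissonMass {r : ℝ} (hr : 0 < r) : HasSum (poissonMass r) 1 := by
  have := hasSum_one_poissonMeasure r.toNNReal
  rwa [Real.coe_toNNReal r hr.le] at this

theorem hasSum_poissonMass_mul_cast {r : ℝ} (hr : 0 < r) :
    HasSum (fun j : ℕ => poissonMass r j * j) r := by
  rw [← hasSum_nat_add_iff' 1]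
  have := (hasSum_poissonMass hr).mul_left r
  simp only [Finset.range_one, Finset.sum_singleton, Nat.cast_zero, mul_zero, sub_zero]
  rw [mul_one] at this
  have e : (fun j : ℕ => poissonMass r (j + 1) * ((j + 1 : ℕ) : ℝ))
      = fun j => r * poissonMass r j := by
    ext j
    rw [← succ_mul_poissonMass_succ]
    push_cast
    ring
  rwa [e]

theorem integrable_poissonMeasure_iff_summable {r : ℝ} (hr : 0 < r) {f : ℕ → ℝ} :
    Integrable f (poissonMeasure r.toNNReal) ↔ Summable fun j => poissonMass r j * |f j| := by
  rw [integrable_poissonMeasure_iff, Real.coe_toNNReal r hr.le]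
  rfl

theorem hasSum_poissonMass_mul {r : ℝ} (hr : 0 < r) {f : ℕ → ℝ}
    (hf : Integrable f (poissonMeasure r.toNNReal)) :
    HasSum (fun j => poissonMass r j * f j) (∫ k, f k ∂poissonMeasure r.toNNReal) := by
  have := hasSum_integral_poissonMeasure hf
  rwa [Real.coe_toNNReal r hr.le] at this

theorem hasSum_poissonMass_indicator {r : ℝ} (hr : 0 < r) (A : Set ℕ) :
    HasSum (fun j => poissonMass r j * A.indicator 1 j) ((poissonMeasure r.toNNReal).real A) := by
  rw [← integral_indicator_one (MeasurableSet.of_discrete (s := A))]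
  refine hasSum_poissonMass_mul hr ?_
  exact (integrable_const (1 : ℝ)).indicator (MeasurableSet.of_discrete (s := A))

/-- The sum telescopes: its term at `i` is the difference of `k * poissonMass r k` between `k = i +
1` and `k = i`. -/
theorem sum_range_sub_mul_poissonMass (r : ℝ) (j : ℕ) :
    ∑ i ∈ Finset.range j, poissonMass r i * (r - i) = j * poissonMass r j := by
  induction j with
  | zero => simp
  | succ j ih =>
    rw [Finset.sum_range_succ, ih, Nat.cast_succ, succ_mul_poissonMass_succ]
    ring

/-- This is the numerator of the Stein solution's increment over the denominator `r * (j *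
poissonMass r j)`. The first summand lies between multiples of `q` and `1 - q` of the second
factor's weight `j * poissonMass r j`, complementary to the bounds on the second summand. -/
theorem abs_stein_increment_le {r : ℝ} (hr : 0 < r) (A : Set ℕ) (j : ℕ) :
    |((j : ℝ) - r) * (∑ i ∈ Finset.range j, poissonMass r i *
        (A.indicator 1 i - (poissonMeasure r.toNNReal).real A))
      + j * poissonMass r j * (A.indicator 1 j - (poissonMeasure r.toNNReal).real A)|
      ≤ j * poissonMass r j := by
  set q := (poissonMeasure r.toNNReal).real A with hq
  set a := ∑ i ∈ Finset.range j, poissonMass r i * A.indicator 1 i with ha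
  set F := ∑ i ∈ Finset.range j, poissonMass r i with hF
  have hsum : ∑ i ∈ Finset.range j, poissonMass r i * (A.indicator 1 i - q) = a - q * F := by
    simp only [mul_sub, Finset.sum_sub_distrib, ← Finset.sum_mul]
    rw [← ha, ← hF]
    ring
  have hπ := fun i => (poissonMass_pos hr i).le
  have hA0 : ∀ i, 0 ≤ A.indicator (1 : ℕ → ℝ) i := fun i =>
    Set.indicator_nonneg (fun _ _ => zero_le_one) i
  have hA1 : ∀ i, A.indicator (1 : ℕ → ℝ) i ≤ 1 := fun i =>
    Set.indicator_le_self' (fun _ _ => zero_le_one) i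
  have ha0 : 0 ≤ a := Finset.sum_nonneg fun i _ => mul_nonneg (hπ i) (hA0 i)
  have haF : a ≤ F := Finset.sum_le_sum fun i _ => mul_le_of_le_one_right (hπ i) (hA1 i)
  have haq : a ≤ q := sum_le_hasSum _ (fun i _ => mul_nonneg (hπ i) (hA0 i))
    (hasSum_poissonMass_indicator hr A)
  have hqa : F - a ≤ 1 - q := by
    rw [hF, ha, ← Finset.sum_sub_distrib]
    exact sum_le_hasSum _ (fun i _ => sub_nonneg.2 (mul_le_of_le_one_right (hπ i) (hA1 i)))
      ((hasSum_poissonMass hr).sub (hasSum_poissonMass_indicator hr A))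
  have hq0 : 0 ≤ q := measureReal_nonneg
  have hq1 : q ≤ 1 := measureReal_le_one
  have hF1 : F ≤ 1 := sum_le_hasSum _ (fun i _ => hπ i) (hasSum_poissonMass hr)
  have hlow : (r - j) * F ≤ j * poissonMass r j := by
    rw [← sum_range_sub_mul_poissonMass, hF, Finset.mul_sum]
    refine Finset.sum_le_sum fun i hi => ?_
    have : (i : ℝ) ≤ j := by exact_mod_cast (Finset.mem_range.1 hi).le
    rw [mul_comm]
    exact mul_le_mul_of_nonneg_left (by linarith) (hπ i)
  have hhigh : (j - r) * (1 - F) ≤ j * poissonMass r j := by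
    have h1 : HasSum (fun i : ℕ => poissonMass r i * i - poissonMass r i * j) (r - 1 * j) :=
      (hasSum_poissonMass_mul_cast hr).sub ((hasSum_poissonMass hr).mul_right (j : ℝ))
    have h2 := sum_le_hasSum (Finset.range j) (fun i hi => by
      have : (j : ℝ) ≤ i := by exact_mod_cast not_lt.1 (fun h => hi (Finset.mem_range.2 h))
      rw [← mul_sub]
      exact mul_nonneg (hπ i) (by linarith)) h1
    rw [Finset.sum_sub_distrib, ← Finset.sum_mul, ← hF] at h2
    have h3 := sum_range_sub_mul_poissonMass r j
    simp only [mul_sub, Finset.sum_sub_distrib, ← Finset.sum_mul] at h3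
    rw [← hF] at h3
    linarith
  rw [hsum]
  set b := A.indicator (1 : ℕ → ℝ) j
  have hb0 : 0 ≤ b := hA0 j
  have hb1 : b ≤ 1 := hA1 j
  set c := (j : ℝ) * poissonMass r j
  have hc : 0 ≤ c := mul_nonneg (Nat.cast_nonneg j) (hπ j)
  have hcb0 := mul_nonneg hc hb0
  have hcb1 := mul_nonneg hc (sub_nonneg.2 hb1)
  rw [abs_le]
  rcases le_total r j with hj | hj
  · have hd : 0 ≤ (j : ℝ) - r := sub_nonneg.2 hj
    have h1 : (j - r) * (a - q * F) ≤ (j - r) * (q * (1 - F)) :=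
      mul_le_mul_of_nonneg_left (by linarith) hd
    have h2 : (j - r) * (q * F - a) ≤ (j - r) * ((1 - q) * (1 - F)) :=
      mul_le_mul_of_nonneg_left (by linarith) hd
    have h3 := mul_le_mul_of_nonneg_left hhigh hq0
    have h4 := mul_le_mul_of_nonneg_left hhigh (sub_nonneg.2 hq1)
    constructor <;> linarith
  · have hd : 0 ≤ r - (j : ℝ) := sub_nonneg.2 hj
    have h1 : (r - j) * (a - q * F) ≤ (r - j) * ((1 - q) * F) :=
      mul_le_mul_of_nonneg_left (by linarith) hd
    have h2 : (r - j) * (q * F - a) ≤ (r - j) * (q * F) :=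
      mul_le_mul_of_nonneg_left (by linarith) hd
    have h3 := mul_le_mul_of_nonneg_left hlow hq0
    have h4 := mul_le_mul_of_nonneg_left hlow (sub_nonneg.2 hq1)
    constructor <;> linarith

/-- The Stein-Chen equation has a solution with increments bounded by `1 / r`. -/
theorem exists_stein_solution {r : ℝ} (hr : 0 < r) (A : Set ℕ) :
    ∃ g : ℕ → ℝ, (∀ j : ℕ, r * g (j + 1) - j * g j
        = A.indicator 1 j - (poissonMeasure r.toNNReal).real A) ∧
      ∀ j, |g (j + 1) - g j| ≤ 1 / r := by
  set q := (poissonMeasure r.toNNReal).real A with hq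
  set G : ℕ → ℝ := fun j => ∑ i ∈ Finset.range j, poissonMass r i * (A.indicator 1 i - q) with hG
  have hGs : ∀ j, G (j + 1) = G j + poissonMass r j * (A.indicator 1 j - q) := fun j =>
    Finset.sum_range_succ _ _
  -- The equation leaves `g 0` free; truncated subtraction sets it equal to `g 1`, so the increment
  -- at `0` vanishes.
  set g : ℕ → ℝ := fun j => G (j - 1 + 1) / (r * poissonMass r (j - 1)) with hg
  have hgs : ∀ j, g (j + 1) = G (j + 1) / (r * poissonMass r j) := fun j => rfl
  have hgj : ∀ j : ℕ, (j : ℝ) * g j = G j / poissonMass r j := by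
    intro j
    cases j with
    | zero => simp [hG]
    | succ j =>
      have h1 := poissonMass_pos hr j
      have h2 := poissonMass_pos hr (j + 1)
      rw [hgs, ← succ_mul_poissonMass_succ]
      push_cast
      field_simp
  refine ⟨g, fun j => ?_, fun j => ?_⟩
  · have h1 := poissonMass_pos hr j
    rw [hgj, hgs, hGs]
    field_simp
    ring
  · rcases Nat.eq_zero_or_pos j with rfl | hj
    · have : g (0 + 1) = g 0 := rfl
      rw [this, sub_self, abs_zero]
      positivity
    · have hj' : (0 : ℝ) < j := by exact_mod_cast hj
      have h1 := poissonMass_pos hr j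
      have h2 : g j = G j / (j * poissonMass r j) := by
        rw [mul_comm, ← div_div, ← hgj]
        field_simp
      have h3 : g (j + 1) - g j = ((j - r) * G j + j * poissonMass r j * (A.indicator 1 j - q))
          / (r * (j * poissonMass r j)) := by
        rw [hgs, h2, hGs]
        field_simp
        ring
      have h4 : 0 < (j : ℝ) * poissonMass r j := mul_pos hj' h1
      rw [h3, abs_div, abs_of_pos (mul_pos hr h4), div_le_div_iff₀ (mul_pos hr h4) hr]
      have h5 := abs_stein_increment_le hr A j
      rw [one_mul, mul_comm]
      exact mul_le_mul_of_nonneg_left h5 hr.le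

/-! ### Ultra-log-concave laws compared with Poisson laws -/

namespace UltraLogConcave

variable {N : ℕ} {w : ℕ → ℝ}

/-- Stein-Chen bound: the probability of any set differs from its Poisson value by at most
`(m - Var) / m`. -/
theorem abs_sum_indicator_sub_poisson_le (h : UltraLogConcave N w) {m : ℝ} (hm0 : 0 < m)
    (hm : ∑ j ∈ Finset.range (N + 1), w j * j = m) (A : Set ℕ) :
    |(∑ j ∈ Finset.range (N + 1), w j * A.indicator 1 j) - (poissonMeasure m.toNNReal).real A|
      ≤ 1 / m * (m - (∑ j ∈ Finset.range (N + 1), w j * (j : ℝ) ^ 2 - m ^ 2)) := by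
  obtain ⟨g, hg, hinc⟩ := exists_stein_solution hm0 A
  set q := (poissonMeasure m.toNNReal).real A
  set s := Finset.range (N + 1)
  have hT : m * ∑ j ∈ s, w j * g (j + 1) - ∑ j ∈ s, w j * (j * g j)
      = (∑ j ∈ s, w j * A.indicator 1 j) - q := by
    calc _ = ∑ j ∈ s, w j * (m * g (j + 1) - j * g j) := by
          rw [Finset.mul_sum, ← Finset.sum_sub_distrib]
          exact Finset.sum_congr rfl fun j _ => by ring
      _ = _ := by
          simp only [hg, mul_sub, Finset.sum_sub_distrib, ← Finset.sum_mul]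
          rw [h.sum_eq_one, one_mul]
  have hid : m * ∑ j ∈ s, w j * ((j + 1 : ℕ) : ℝ) - ∑ j ∈ s, w j * (j * (j : ℝ))
      = m - (∑ j ∈ s, w j * (j : ℝ) ^ 2 - m ^ 2) := by
    simp only [Nat.cast_succ, mul_add, Finset.sum_add_distrib, mul_one, hm, h.sum_eq_one, s,
      ← pow_two]
    ring
  have hlin : ∀ ε : ℝ, |ε| = 1 → 0 ≤ 1 / m * (m - (∑ j ∈ s, w j * (j : ℝ) ^ 2 - m ^ 2))
      + ε * ((∑ j ∈ s, w j * A.indicator 1 j) - q) := by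
    intro ε hε
    -- The slope `1 / m` absorbs any decrease of `ε * g`, so the size-bias inequality applies; its
    -- linear part yields the variance defect.
    have hmono : Monotone fun j : ℕ => 1 / m * (j : ℝ) + ε * g j := by
      refine monotone_nat_of_le_succ fun j => ?_
      have h1 : |ε * (g (j + 1) - g j)| ≤ 1 / m := by rw [abs_mul, hε, one_mul]; exact hinc j
      have h2 := (abs_le.1 h1).1
      push_cast
      linarith
    have h1 := h.sum_sizeBias_le hmono
    rw [hm] at h1
    have e1 : ∑ j ∈ s, w j * (j * (1 / m * (j : ℝ) + ε * g j))
        = 1 / m * ∑ j ∈ s, w j * (j * (j : ℝ)) + ε * ∑ j ∈ s, w j * (j * g j) := by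
      rw [Finset.mul_sum, Finset.mul_sum, ← Finset.sum_add_distrib]
      exact Finset.sum_congr rfl fun j _ => by ring
    have e2 : ∑ j ∈ s, w j * (1 / m * ((j + 1 : ℕ) : ℝ) + ε * g (j + 1))
        = 1 / m * ∑ j ∈ s, w j * ((j + 1 : ℕ) : ℝ) + ε * ∑ j ∈ s, w j * g (j + 1) := by
      rw [Finset.mul_sum, Finset.mul_sum, ← Finset.sum_add_distrib]
      exact Finset.sum_congr rfl fun j _ => by ring
    rw [e1, e2] at h1
    rw [← hT, ← hid]
    linarith
  have h1 := hlin 1 (by simp)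
  have h2 := hlin (-1) (by simp)
  rw [abs_le]
  constructor <;> linarith

/-- The set where an ultra-log-concave mass function exceeds a Poisson one is an interval. -/
theorem poissonMass_le_of_between (h : UltraLogConcave N w) {r : ℝ} (hr : 0 < r) {a j b : ℕ}
    (ha : poissonMass r a ≤ w a) (hb : poissonMass r b ≤ w b) (haj : a ≤ j) (hjb : j ≤ b) :
    poissonMass r j ≤ w j := by
  by_contra hj
  have hstep : ∀ P : ℕ → Prop, ∀ u v : ℕ, u ≤ v → P u → ¬ P v →
      ∃ i, u ≤ i ∧ i < v ∧ P i ∧ ¬ P (i + 1) := by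
    intro P u v huv hu
    induction v, huv using Nat.le_induction with
    | base => exact fun hv => absurd hu hv
    | succ v huv ih =>
      intro hv
      by_cases hPv : P v
      · exact ⟨v, huv, Nat.lt_succ_self v, hPv, hv⟩
      · obtain ⟨i, h1, h2, h3⟩ := ih hPv
        exact ⟨i, h1, by omega, h3⟩
  -- A dip at `j` forces a down-crossing at `i` and a later up-crossing at `k`, against the decrease
  -- of the successive ratios.
  obtain ⟨i, -, hij, hi, hi1⟩ := hstep (fun k => poissonMass r k ≤ w k) a j haj ha hj
  obtain ⟨k, hjk, -, hk, hk1⟩ := hstep (fun k => ¬ poissonMass r k ≤ w k) j b hjb hj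
    (not_not.2 hb)
  rw [not_not] at hk1
  rw [not_le] at hi1 hk
  have h0 := h.ratio i k (by omega)
  have pi := poissonMass_pos hr i
  have pk := poissonMass_pos hr k
  have h1 : r * poissonMass r k * poissonMass r i ≤ ((k : ℝ) + 1) * w (k + 1) * w i := by
    rw [← succ_mul_poissonMass_succ]
    have : 0 ≤ w (k + 1) := h.nonneg _
    gcongr
  have h2 : ((i : ℝ) + 1) * w (i + 1) * w k < r * poissonMass r i * poissonMass r k := by
    rw [← succ_mul_poissonMass_succ]
    have h3 : (0 : ℝ) < (i : ℝ) + 1 := by positivity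
    have := h.nonneg k
    calc ((i : ℝ) + 1) * w (i + 1) * w k ≤ ((i : ℝ) + 1) * poissonMass r (i + 1) * w k := by
          gcongr
      _ < _ := mul_lt_mul_of_pos_left hk (mul_pos h3 (poissonMass_pos hr _))
  linarith

/-- A chord of a convex function separates its excess according to the sign of `w - Po(r)`. -/
theorem exists_affine_mul_sub_le (h : UltraLogConcave N w) {r : ℝ} (hr : 0 < r) {f : ℝ → ℝ}
    (hf : ConvexOn ℝ Set.univ f) :
    ∃ α β : ℝ, ∀ j : ℕ, w j * (f j - (α + β * j)) ≤ poissonMass r j * (f j - (α + β * j)) := by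
  set S := (Finset.range (N + 1)).filter fun j => poissonMass r j < w j with hS
  have hSmem : ∀ j, j ∈ S ↔ poissonMass r j < w j := by
    intro j
    rw [hS, Finset.mem_filter, Finset.mem_range]
    refine ⟨And.right, fun hj => ⟨?_, hj⟩⟩
    by_contra hN
    have := h.eq_zero j (by omega)
    have := poissonMass_pos hr j
    linarith
  have hne : S.Nonempty := by
    by_contra hemp
    rw [Finset.not_nonempty_iff_eq_empty] at hemp
    have hle : ∀ j, w j ≤ poissonMass r j := fun j => by
      by_contra hj
      have := (hSmem j).2 (not_le.1 hj)
      simp [hemp] at this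
    have h1 : ∑ j ∈ Finset.range (N + 2), poissonMass r j ≤ 1 :=
      sum_le_hasSum _ (fun i _ => (poissonMass_pos hr i).le) (hasSum_poissonMass hr)
    rw [Finset.sum_range_succ] at h1
    have h2 : ∑ j ∈ Finset.range (N + 1), w j ≤ ∑ j ∈ Finset.range (N + 1), poissonMass r j :=
      Finset.sum_le_sum fun j _ => hle j
    have := poissonMass_pos hr (N + 1)
    rw [h.sum_eq_one] at h2
    linarith
  set a := S.min' hne
  set b₀ := S.max' hne
  have ha := ((hSmem a).1 (S.min'_mem hne)).le
  have hb := ((hSmem b₀).1 (S.max'_mem hne)).le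
  -- A chord needs two distinct nodes even if `S` is a single point. The excess vanishes at both
  -- nodes, so no sign of `w - Po(r)` is needed there.
  obtain ⟨b, hbdef⟩ : ∃ b, b = max b₀ (a + 1) := ⟨_, rfl⟩
  have hab : (0 : ℝ) < (b : ℝ) - a := by
    have : a < b := by omega
    exact sub_pos.2 (by exact_mod_cast this)
  set β := (f b - f a) / (b - a) with hβ
  have hβ' : β * (b - a) = f b - f a := div_mul_cancel₀ _ hab.ne'
  refine ⟨f a - β * a, β, fun j => ?_⟩
  have hout : w j ≤ poissonMass r j → 0 ≤ f j - (f a - β * a + β * j) →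
      w j * (f j - (f a - β * a + β * j)) ≤ poissonMass r j * (f j - (f a - β * a + β * j)) :=
    fun h1 h2 => mul_le_mul_of_nonneg_right h1 h2
  have hconv : ∀ {x y z : ℝ}, x < y → y < z → (z - x) * f y ≤ (z - y) * f x + (y - x) * f z :=
    fun hxy hyz => hf.secant_mono_aux1 (Set.mem_univ _) (Set.mem_univ _) hxy hyz
  rcases lt_trichotomy j a with hja | hja | hja
  · refine hout ?_ ?_
    · by_contra hj
      have := S.min'_le j ((hSmem j).2 (not_le.1 hj))
      omega
    · have hja' : (j : ℝ) < a := by exact_mod_cast hja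
      have := hconv hja' (sub_pos.1 hab)
      refine le_of_mul_le_mul_left ?_ hab
      linear_combination this + (j - a) * hβ'
  · subst hja
    have : f a - (f a - β * a + β * a) = 0 := by ring
    rw [this, mul_zero, mul_zero]
  · rcases lt_trichotomy j b with hjb | hjb | hjb
    · have h1 := h.poissonMass_le_of_between hr ha hb hja.le (by omega)
      refine mul_le_mul_of_nonpos_right h1 ?_
      have hja' : (a : ℝ) < j := by exact_mod_cast hja
      have hjb' : (j : ℝ) < b := by exact_mod_cast hjb
      have := hconv hja' hjb'
      refine le_of_mul_le_mul_left ?_ hab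
      linear_combination this - (j - a) * hβ'
    · have : f j - (f a - β * a + β * j) = 0 := by
        rw [hjb]
        linear_combination -hβ'
      rw [this, mul_zero, mul_zero]
    · refine hout ?_ ?_
      · by_contra hj
        have := S.le_max' j ((hSmem j).2 (not_le.1 hj))
        omega
      · have hjb' : (b : ℝ) < j := by exact_mod_cast hjb
        have := hconv (sub_pos.1 hab) hjb'
        refine le_of_mul_le_mul_left ?_ hab
        linear_combination this + (j - a) * hβ'

/-- Convex domination by the Poisson distribution with the same mean. -/
theorem sum_convex_le (h : UltraLogConcave N w) {m : ℝ} (hm0 : 0 < m)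
    (hm : ∑ j ∈ Finset.range (N + 1), w j * j = m) {f : ℝ → ℝ} (hf : ConvexOn ℝ Set.univ f)
    {E : ℝ} (hE : HasSum (fun j : ℕ => poissonMass m j * f j) E) :
    ∑ j ∈ Finset.range (N + 1), w j * f j ≤ E := by
  obtain ⟨α, β, hαβ⟩ := h.exists_affine_mul_sub_le hm0 hf
  have h1 : HasSum (fun j : ℕ => w j * (f j - (α + β * j)))
      (∑ j ∈ Finset.range (N + 1), w j * (f j - (α + β * j))) := by
    refine hasSum_sum_of_ne_finset_zero fun j hj => ?_
    rw [Finset.mem_range, not_lt] at hj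
    rw [h.eq_zero j (by omega), zero_mul]
  have h2 : HasSum (fun j : ℕ => poissonMass m j * (f j - (α + β * j)))
      (E - (1 * α + m * β)) := by
    have e : (fun j : ℕ => poissonMass m j * (f j - (α + β * j))) = fun j : ℕ =>
        poissonMass m j * f j - (poissonMass m j * α + poissonMass m j * j * β) := by
      ext j
      ring
    rw [e]
    exact hE.sub (((hasSum_poissonMass hm0).mul_right α).add
      ((hasSum_poissonMass_mul_cast hm0).mul_right β))
  have h3 := hasSum_le hαβ h1 h2
  have h4 : ∑ j ∈ Finset.range (N + 1), w j * (f j - (α + β * j))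
      = ∑ j ∈ Finset.range (N + 1), w j * f j - (1 * α + m * β) := by
    rw [← h.sum_eq_one, ← hm, Finset.sum_mul, Finset.sum_mul, ← Finset.sum_add_distrib,
      ← Finset.sum_sub_distrib]
    exact Finset.sum_congr rfl fun j _ => by ring
  linarith

end UltraLogConcave

/-! ### The mass function and integrals of the CMB law -/

variable {n : ℕ} {p ν : ℝ}

theorem normalizer_pos (hp0 : 0 < p) (hp1 : p ≤ 1) : 0 < normalizer n p ν := by
  have hq : 0 ≤ 1 - p := sub_nonneg.2 hp1
  refine Finset.sum_pos' (fun i _ => by positivity) ⟨n, Finset.self_mem_range_succ n, ?_⟩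
  simp only [Nat.choose_self, Nat.cast_one, Real.one_rpow, Nat.sub_self, pow_zero, mul_one, one_mul]
  positivity

theorem pmfReal_nonneg (hp0 : 0 < p) (hp1 : p ≤ 1) (j : ℕ) : 0 ≤ pmfReal n p ν j := by
  have hq : 0 ≤ 1 - p := sub_nonneg.2 hp1
  have := normalizer_pos (n := n) (ν := ν) hp0 hp1
  unfold pmfReal
  split_ifs <;> positivity

theorem pmfReal_eq_zero {j : ℕ} (hj : n < j) : pmfReal n p ν j = 0 :=
  if_neg (not_le.2 hj)

theorem pmfReal_self_pos (hp0 : 0 < p) (hp1 : p ≤ 1) : 0 < pmfReal n p ν n := by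
  have := normalizer_pos (n := n) (ν := ν) hp0 hp1
  simp only [pmfReal, le_refl, if_true, Nat.choose_self, Nat.cast_one, Real.one_rpow, Nat.sub_self,
    pow_zero, mul_one, one_mul]
  positivity

theorem sum_pmfReal (hp0 : 0 < p) (hp1 : p ≤ 1) :
    ∑ j ∈ Finset.range (n + 1), pmfReal n p ν j = 1 := by
  rw [← div_self (normalizer_pos (n := n) (ν := ν) hp0 hp1).ne']
  conv_rhs => rw [normalizer, Finset.sum_div]
  refine Finset.sum_congr rfl fun j hj => ?_
  rw [pmfReal, if_pos (Nat.lt_succ_iff.1 (Finset.mem_range.1 hj)), normalizer]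

theorem succ_rpow_mul_pmfReal_succ {k : ℕ} (hk : k < n) :
    ((k : ℝ) + 1) ^ ν * pmfReal n p ν (k + 1) = (n.choose k : ℝ) ^ ν * ((n : ℝ) - k) ^ ν *
      p ^ (k + 1) * (1 - p) ^ (n - (k + 1)) / normalizer n p ν := by
  have h1 : (n.choose (k + 1) : ℝ) * ((k : ℝ) + 1) = n.choose k * ((n : ℝ) - k) := by
    have := Nat.choose_succ_right_eq n k
    rw [← Nat.cast_sub hk.le]
    exact_mod_cast this
  have h2 : (0 : ℝ) ≤ (n : ℝ) - k := sub_nonneg.2 (by exact_mod_cast hk.le)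
  rw [pmfReal, if_pos (by omega), ← Real.mul_rpow (by positivity) h2, ← h1,
    Real.mul_rpow (by positivity) (by positivity)]
  ring

/-- After common factors cancel, this is `(n - j)^ν ≤ (n - i)^ν`; for `j ≥ n` the left side is zero.
-/
theorem rpow_mul_pmfReal_ratio (hp0 : 0 < p) (hp1 : p ≤ 1) (hν : 0 ≤ ν) {i j : ℕ} (hij : i ≤ j) :
    ((j : ℝ) + 1) ^ ν * pmfReal n p ν (j + 1) * pmfReal n p ν i
      ≤ ((i : ℝ) + 1) ^ ν * pmfReal n p ν (i + 1) * pmfReal n p ν j := by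
  have hw := fun k => pmfReal_nonneg (n := n) (ν := ν) hp0 hp1 k
  rcases Nat.lt_or_ge j n with hj | hj
  · have hi : i < n := by omega
    have hq : 0 ≤ 1 - p := sub_nonneg.2 hp1
    have hZ := normalizer_pos (n := n) (ν := ν) hp0 hp1
    rw [succ_rpow_mul_pmfReal_succ hj, succ_rpow_mul_pmfReal_succ hi, pmfReal, pmfReal,
      if_pos hi.le, if_pos hj.le]
    obtain ⟨d, rfl⟩ := Nat.exists_eq_add_of_lt hj
    obtain ⟨e, rfl⟩ := Nat.exists_eq_add_of_le hij
    have e1 : i + e + d + 1 - (i + e + 1) = d := by omega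
    have e2 : i + e + d + 1 - (i + 1) = e + d := by omega
    have e3 : i + e + d + 1 - i = e + d + 1 := by omega
    have e4 : i + e + d + 1 - (i + e) = d + 1 := by omega
    rw [e1, e2, e3, e4]
    set N := i + e + d + 1
    set Z := normalizer N p ν
    have h1 : ((N : ℝ) - (i + e : ℕ)) ^ ν ≤ ((N : ℝ) - i) ^ ν := by
      refine Real.rpow_le_rpow (sub_nonneg.2 (by exact_mod_cast hj.le)) ?_ hν
      push_cast
      have : (0 : ℝ) ≤ e := Nat.cast_nonneg e
      linarith
    have h2 : 0 ≤ (N.choose i : ℝ) ^ ν * (N.choose (i + e) : ℝ) ^ ν * p ^ (i + (i + e) + 1) *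
        (1 - p) ^ (d + (e + d) + 1) / Z ^ 2 := by positivity
    have h3 := mul_le_mul_of_nonneg_left h1 h2
    refine (le_of_eq ?_).trans (h3.trans (le_of_eq ?_)) <;>
    · field_simp
      ring
  · rw [pmfReal_eq_zero (Nat.lt_succ_of_le hj), mul_zero, zero_mul]
    have := hw (i + 1)
    have := hw j
    positivity

theorem ultraLogConcave_pmfReal (hp0 : 0 < p) (hp1 : p ≤ 1) (hν : 1 ≤ ν) :
    UltraLogConcave n (pmfReal n p ν) where
  nonneg := pmfReal_nonneg hp0 hp1
  eq_zero _ := pmfReal_eq_zero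
  sum_eq_one := sum_pmfReal hp0 hp1
  ratio i j hij := by
    have hw := fun k => pmfReal_nonneg (n := n) (ν := ν) hp0 hp1 k
    have hsplit : ∀ k : ℕ, (k : ℝ) + 1 = ((k : ℝ) + 1) ^ (1 - ν) * ((k : ℝ) + 1) ^ ν := fun k => by
      rw [← Real.rpow_add (by positivity), sub_add_cancel, Real.rpow_one]
    have hle : ((j : ℝ) + 1) ^ (1 - ν) ≤ ((i : ℝ) + 1) ^ (1 - ν) :=
      Real.rpow_le_rpow_of_nonpos (by positivity)
        (by have : (i : ℝ) ≤ j := by exact_mod_cast hij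
            linarith) (by linarith)
    have h1 := rpow_mul_pmfReal_ratio (n := n) hp0 hp1 (zero_le_one.trans hν) hij
    have := hw (j + 1)
    have := hw (i + 1)
    have := hw i
    have := hw j
    rw [hsplit j, hsplit i, mul_assoc, mul_assoc, mul_assoc, mul_assoc, ← mul_assoc (_ ^ ν),
      ← mul_assoc (_ ^ ν)]
    exact mul_le_mul hle h1 (by positivity) (by positivity)

theorem integrable_cmbMeasure (f : ℕ → ℝ) : Integrable f (cmbMeasure n p ν) := by
  rw [cmbMeasure, integrable_sum_dirac_iff (by simp)]
  refine summable_of_ne_finset_zero (s := Finset.range (n + 1)) fun j hj => ?_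
  rw [Finset.mem_range, not_lt] at hj
  rw [pmfReal_eq_zero (by omega)]
  simp

theorem integral_cmbMeasure (hp0 : 0 < p) (hp1 : p ≤ 1) (f : ℕ → ℝ) :
    ∫ k, f k ∂cmbMeasure n p ν = ∑ j ∈ Finset.range (n + 1), pmfReal n p ν j * f j := by
  rw [cmbMeasure, integral_sum_dirac (by simp), tsum_eq_sum (s := Finset.range (n + 1))]
  · simp [ENNReal.toReal_ofReal (pmfReal_nonneg hp0 hp1 _)]
  · intro j hj
    rw [Finset.mem_range, not_lt] at hj
    rw [pmfReal_eq_zero (by omega)]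
    simp

theorem measureReal_cmbMeasure (hp0 : 0 < p) (hp1 : p ≤ 1) (A : Set ℕ) :
    (cmbMeasure n p ν).real A
      = ∑ j ∈ Finset.range (n + 1), pmfReal n p ν j * A.indicator 1 j := by
  rw [← integral_indicator_one (MeasurableSet.of_discrete (s := A)), integral_cmbMeasure hp0 hp1]

theorem lintegral_ofReal_cmbMeasure (hp0 : 0 < p) (hp1 : p ≤ 1) {f : ℕ → ℝ} (hf : ∀ k, 0 ≤ f k) :
    ∫⁻ k, ENNReal.ofReal (f k) ∂cmbMeasure n p ν
      = ENNReal.ofReal (∑ j ∈ Finset.range (n + 1), pmfReal n p ν j * f j) := by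
  rw [← integral_cmbMeasure hp0 hp1, ofReal_integral_eq_lintegral_ofReal (integrable_cmbMeasure f)
    (Filter.Eventually.of_forall hf)]

theorem integral_powerBias_cmbMeasure (hp0 : 0 < p) (hp1 : p ≤ 1) (α : ℝ) (f : ℕ → ℝ) :
    ∫ k, f k ∂powerBias α (cmbMeasure n p ν)
      = (∑ j ∈ Finset.range (n + 1), pmfReal n p ν j * (j : ℝ) ^ α * f j) /
        ∑ j ∈ Finset.range (n + 1), pmfReal n p ν j * (j : ℝ) ^ α := by
  rw [powerBias, integral_withDensity_eq_integral_toReal_smul .of_discrete (by simp),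
    integral_cmbMeasure hp0 hp1, integral_cmbMeasure hp0 hp1, Finset.sum_div]
  refine Finset.sum_congr rfl fun j _ => ?_
  have : 0 ≤ (j : ℝ) ^ α / ∑ j ∈ Finset.range (n + 1), pmfReal n p ν j * (j : ℝ) ^ α :=
    div_nonneg (by positivity) (Finset.sum_nonneg fun j _ =>
      mul_nonneg (pmfReal_nonneg hp0 hp1 j) (by positivity))
  rw [ENNReal.toReal_ofReal this, smul_eq_mul]
  ring

theorem sum_pmfReal_mul_rpow_pos (hn : 1 ≤ n) (hp0 : 0 < p) (hp1 : p ≤ 1) (α : ℝ) :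
    0 < ∑ j ∈ Finset.range (n + 1), pmfReal n p ν j * (j : ℝ) ^ α := by
  refine Finset.sum_pos' (fun j _ => mul_nonneg (pmfReal_nonneg hp0 hp1 j) (by positivity))
    ⟨n, Finset.self_mem_range_succ n, mul_pos (pmfReal_self_pos hp0 hp1) ?_⟩
  have : (0 : ℝ) < n := by exact_mod_cast hn
  positivity

/-! ### Stochastic orders, convex order, Poincaré constant and total variation -/

theorem stLE_powerBias_one (hn : 1 ≤ n) (hp0 : 0 < p) (hp1 : p ≤ 1) (hν : 1 ≤ ν) :
    StLE (powerBias 1 (cmbMeasure n p ν)) (powerBias ν (cmbMeasure n p ν)) := by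
  intro f hf _ _
  rw [integral_powerBias_cmbMeasure hp0 hp1, integral_powerBias_cmbMeasure hp0 hp1,
    div_le_div_iff₀ (sum_pmfReal_mul_rpow_pos hn hp0 hp1 _) (sum_pmfReal_mul_rpow_pos hn hp0 hp1 _)]
  refine sum_mul_sum_le_of_likelihoodRatio _ _ _ (fun k : ℕ => f k)
    (hf.comp Nat.mono_cast) fun i j hij => ?_
  have hij' : (i : ℝ) ≤ j := by exact_mod_cast hij
  have hsplit : ∀ k : ℕ, (k : ℝ) ^ ν = k * (k : ℝ) ^ (ν - 1) := fun k => by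
    rw [← Real.rpow_one_add' (by positivity) (by linarith), add_sub_cancel]
  have h1 : (i : ℝ) ^ (ν - 1) ≤ (j : ℝ) ^ (ν - 1) :=
    Real.rpow_le_rpow (by positivity) hij' (by linarith)
  rw [hsplit i, hsplit j, Real.rpow_one, Real.rpow_one]
  have h2 : 0 ≤ pmfReal n p ν i * pmfReal n p ν j * i * j :=
    mul_nonneg (mul_nonneg (mul_nonneg (pmfReal_nonneg hp0 hp1 i) (pmfReal_nonneg hp0 hp1 j))
      i.cast_nonneg) j.cast_nonneg
  have := mul_le_mul_of_nonneg_left h1 h2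
  linarith

/-- Reindexed by `j + 1`, the biased law has weights `(j+1)^ν w(j+1)`, whose ratio to `w j`
decreases. -/
theorem integral_powerBias_le_integral_succ (hn : 1 ≤ n) (hp0 : 0 < p) (hp1 : p ≤ 1) (hν : 1 ≤ ν)
    {f : ℕ → ℝ} (hf : Monotone f) :
    ∫ k, f k ∂powerBias ν (cmbMeasure n p ν) ≤ ∫ k, f (k + 1) ∂cmbMeasure n p ν := by
  rw [integral_powerBias_cmbMeasure hp0 hp1, integral_cmbMeasure hp0 hp1,
    div_le_iff₀ (sum_pmfReal_mul_rpow_pos hn hp0 hp1 _)]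
  have hshift : ∀ F : ℕ → ℝ, ∑ j ∈ Finset.range (n + 1), pmfReal n p ν j * (j : ℝ) ^ ν * F j
      = ∑ j ∈ Finset.range (n + 1), ((j : ℝ) + 1) ^ ν * pmfReal n p ν (j + 1) * F (j + 1) := by
    intro F
    have h1 := Finset.sum_range_succ (fun j : ℕ => pmfReal n p ν j * (j : ℝ) ^ ν * F j) (n + 1)
    have h2 := Finset.sum_range_succ' (fun j : ℕ => pmfReal n p ν j * (j : ℝ) ^ ν * F j) (n + 1)
    rw [h1, pmfReal_eq_zero (Nat.lt_succ_self n), Nat.cast_zero,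
      Real.zero_rpow (by linarith)] at h2
    simp only [zero_mul, add_zero, mul_zero] at h2
    rw [h2]
    refine Finset.sum_congr rfl fun j _ => ?_
    push_cast
    ring
  have h1 := sum_mul_sum_le_of_likelihoodRatio (Finset.range (n + 1))
    (fun j : ℕ => ((j : ℝ) + 1) ^ ν * pmfReal n p ν (j + 1)) (pmfReal n p ν) (fun j => f (j + 1))
    (fun i j hij => hf (by omega))
    (fun i j hij => rpow_mul_pmfReal_ratio hp0 hp1 (zero_le_one.trans hν) hij)
  have h2 := hshift fun _ => 1
  simp only [mul_one] at h2
  rwa [sum_pmfReal hp0 hp1, mul_one, ← hshift f, ← h2] at h1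

theorem hasSum_poissonMass_mul_exp {m : ℝ} (θ : ℝ) :
    HasSum (fun j : ℕ => poissonMass m j * Real.exp (θ * j))
      (Real.exp (m * (Real.exp θ - 1))) := by
  have h := (NormedSpace.expSeries_div_hasSum_exp (m * Real.exp θ)).mul_left (Real.exp (-m))
  rw [← Real.exp_eq_exp_ℝ, ← Real.exp_add] at h
  have e : (fun j : ℕ => poissonMass m j * Real.exp (θ * j))
      = fun j : ℕ => Real.exp (-m) * ((m * Real.exp θ) ^ j / (j.factorial : ℝ)) := by
    ext j
    rw [poissonMass, mul_comm θ, Real.exp_nat_mul, mul_pow]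
    ring
  have e2 : m * (Real.exp θ - 1) = -m + m * Real.exp θ := by ring
  rwa [e, e2]

theorem cxLE_poissonMeasure (hp0 : 0 < p) (hp1 : p ≤ 1) (hν : 1 ≤ ν) {m : ℝ} (hm0 : 0 < m)
    (hm : ∑ j ∈ Finset.range (n + 1), pmfReal n p ν j * j = m) :
    CxLE (cmbMeasure n p ν) (poissonMeasure m.toNNReal) := by
  have hint : Integrable (fun k : ℕ => (k : ℝ)) (poissonMeasure m.toNNReal) := by
    rw [integrable_poissonMeasure_iff_summable hm0]
    simpa using (hasSum_poissonMass_mul_cast hm0).summable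
  refine ⟨integrable_cmbMeasure _, hint, ?_, fun f hf hfi => ⟨integrable_cmbMeasure _, ?_⟩⟩
  · rw [integral_cmbMeasure hp0 hp1, hm]
    exact (hasSum_poissonMass_mul_cast hm0).unique (hasSum_poissonMass_mul hm0 hint)
  · rw [integral_cmbMeasure hp0 hp1]
    exact (ultraLogConcave_pmfReal hp0 hp1 hν).sum_convex_le hm0 hm hf
      (hasSum_poissonMass_mul hm0 hfi)

theorem integral_exp_le (hp0 : 0 < p) (hp1 : p ≤ 1) (hν : 1 ≤ ν) {m : ℝ} (hm0 : 0 < m)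
    (hm : ∑ j ∈ Finset.range (n + 1), pmfReal n p ν j * j = m) (θ : ℝ) :
    ∫ k, Real.exp (θ * (k : ℕ)) ∂cmbMeasure n p ν ≤ Real.exp (m * (Real.exp θ - 1)) := by
  rw [integral_cmbMeasure hp0 hp1]
  have hconv : ConvexOn ℝ Set.univ fun x : ℝ => Real.exp (θ * x) :=
    convexOn_exp.comp_linearMap (LinearMap.mul ℝ ℝ θ)
  exact (ultraLogConcave_pmfReal hp0 hp1 hν).sum_convex_le hm0 hm hconv
    (hasSum_poissonMass_mul_exp θ)

theorem poincareConst_le (hp0 : 0 < p) (hp1 : p ≤ 1) (hν : 1 ≤ ν) {m : ℝ}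
    (hm : ∑ j ∈ Finset.range (n + 1), pmfReal n p ν j * j = m) :
    poincareConst (cmbMeasure n p ν) ≤ ENNReal.ofReal m := by
  refine iSup₂_le fun g hg => ENNReal.div_le_of_le_mul ?_
  have hm' : 0 ≤ m := hm ▸ Finset.sum_nonneg fun j _ =>
    mul_nonneg (pmfReal_nonneg hp0 hp1 j) j.cast_nonneg
  rw [lintegral_ofReal_cmbMeasure hp0 hp1 fun k => sq_nonneg _,
    lintegral_ofReal_cmbMeasure hp0 hp1 fun k => sq_nonneg _, ← ENNReal.ofReal_mul hm', ← hm]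
  refine ENNReal.ofReal_le_ofReal ((ultraLogConcave_pmfReal hp0 hp1 hν).sum_sq_le g ?_)
  rw [← integral_cmbMeasure hp0 hp1]
  exact hg.2

/-- The test function `k - m` has unit increments, so its ratio is the variance. -/
theorem le_poincareConst (hp0 : 0 < p) (hp1 : p ≤ 1) {m : ℝ}
    (hm : ∑ j ∈ Finset.range (n + 1), pmfReal n p ν j * j = m) :
    ENNReal.ofReal (∑ j ∈ Finset.range (n + 1), pmfReal n p ν j * ((j : ℝ) - m) ^ 2)
      ≤ poincareConst (cmbMeasure n p ν) := by
  have hc : (fun k : ℕ => (k : ℝ) - m) ∈ centred (cmbMeasure n p ν) := by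
    refine ⟨(memLp_two_iff_integrable_sq .of_discrete).2 (integrable_cmbMeasure _), ?_⟩
    rw [integral_cmbMeasure hp0 hp1]
    simp only [mul_sub, Finset.sum_sub_distrib, ← Finset.sum_mul]
    rw [hm, sum_pmfReal hp0 hp1]
    ring
  refine le_trans (le_of_eq ?_) (le_iSup₂ (f := fun g (_ : g ∈ centred (cmbMeasure n p ν)) =>
    (∫⁻ k, ENNReal.ofReal (g k ^ 2) ∂cmbMeasure n p ν) /
      (∫⁻ k, ENNReal.ofReal ((g (k + 1) - g k) ^ 2) ∂cmbMeasure n p ν)) _ hc)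
  rw [lintegral_ofReal_cmbMeasure hp0 hp1 fun k => sq_nonneg _,
    lintegral_ofReal_cmbMeasure hp0 hp1 fun k => sq_nonneg _]
  have : ∀ j : ℕ, (((j + 1 : ℕ) : ℝ) - m - ((j : ℝ) - m)) ^ 2 = 1 := fun j => by
    push_cast
    ring
  simp only [this, mul_one]
  rw [sum_pmfReal hp0 hp1, ENNReal.ofReal_one, div_one]

theorem dTV_poissonMeasure_le (hp0 : 0 < p) (hp1 : p ≤ 1) (hν : 1 ≤ ν) {m : ℝ} (hm0 : 0 < m)
    (hm : ∑ j ∈ Finset.range (n + 1), pmfReal n p ν j * j = m) :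
    dTV (cmbMeasure n p ν) (poissonMeasure m.toNNReal)
      ≤ 1 / m * (m - ∑ j ∈ Finset.range (n + 1), pmfReal n p ν j * ((j : ℝ) - m) ^ 2) := by
  have h := ultraLogConcave_pmfReal (n := n) hp0 hp1 hν
  have hvar : ∑ j ∈ Finset.range (n + 1), pmfReal n p ν j * ((j : ℝ) - m) ^ 2
      = ∑ j ∈ Finset.range (n + 1), pmfReal n p ν j * (j : ℝ) ^ 2 - m ^ 2 := by
    calc _ = ∑ j ∈ Finset.range (n + 1), (pmfReal n p ν j * (j : ℝ) ^ 2
          - 2 * m * (pmfReal n p ν j * j) + m ^ 2 * pmfReal n p ν j) :=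
          Finset.sum_congr rfl fun j _ => by ring
      _ = _ := by
          rw [Finset.sum_add_distrib, Finset.sum_sub_distrib, ← Finset.mul_sum, ← Finset.mul_sum,
            hm, h.sum_eq_one]
          ring
  refine ciSup_le fun A => ?_
  rw [measureReal_cmbMeasure hp0 hp1, hvar]
  exact h.abs_sum_indicator_sub_poisson_le hm0 hm A

end CMB

/-! ### Transfer to the random variable -/

theorem mainTheorem11 {Ω : Type*} [MeasurableSpace Ω] (P : Measure Ω) [IsProbabilityMeasure P]
    (n : ℕ) (hn : 1 ≤ n) (p ν : ℝ) (hp0 : 0 < p) (hp1 : p ≤ 1) (hν : 1 ≤ ν)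
    (Y : Ω → ℕ) (hY : HasLaw Y (CMB.cmbMeasure n p ν) P)
    (μ : ℝ) (hμ : μ = ∫ ω, (Y ω : ℝ) ∂P) :
    -- total variation distance to the Poisson distribution with mean `μ`
    CMB.dTV (P.map Y) (poissonMeasure μ.toNNReal) ≤ 1 / μ * (μ - Var[fun ω => (Y ω : ℝ); P]) ∧
    -- bounds on the Poincaré constant
    (ENNReal.ofReal (Var[fun ω => (Y ω : ℝ); P]) ≤ CMB.poincareConst (P.map Y) ∧
      CMB.poincareConst (P.map Y) ≤ ENNReal.ofReal μ) ∧
    -- convex order and concentration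
    CMB.CxLE (P.map Y) (poissonMeasure μ.toNNReal) ∧
    (∀ t : ℝ, 0 ≤ t →
      P.real {ω | μ + t ≤ (Y ω : ℝ)} ≤ Real.exp t * (1 + t / μ) ^ (-(μ + t))) ∧
    (∀ t : ℝ, 0 ≤ t → t < μ →
      P.real {ω | (Y ω : ℝ) ≤ μ - t} ≤ Real.exp (-t) * (1 - t / μ) ^ (t - μ)) ∧
    -- stochastic orderings between the power-biased laws of `Y` and the law of `Y + 1`
    CMB.StLE (CMB.powerBias 1 (P.map Y)) (CMB.powerBias ν (P.map Y)) ∧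
    CMB.StLE (CMB.powerBias ν (P.map Y)) (P.map fun ω => Y ω + 1) := by
  have hYm := hY.aemeasurable
  have hint : ∀ f : ℕ → ℝ, ∫ ω, f (Y ω) ∂P = ∫ k, f k ∂CMB.cmbMeasure n p ν := fun f => by
    rw [← hY.map_eq, integral_map hYm .of_discrete]
  have hm : ∑ j ∈ Finset.range (n + 1), CMB.pmfReal n p ν j * (j : ℝ) = μ := by
    rw [hμ, hint fun k => (k : ℝ), CMB.integral_cmbMeasure hp0 hp1]
  have hμ0 : 0 < μ := by
    have := CMB.sum_pmfReal_mul_rpow_pos (ν := ν) hn hp0 hp1 1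
    simpa only [Real.rpow_one, hm] using this
  have hYr : AEMeasurable (fun ω => (Y ω : ℝ)) P :=
    (Measurable.of_discrete (f := fun k : ℕ => (k : ℝ))).comp_aemeasurable hYm
  have hvar : Var[fun ω => (Y ω : ℝ); P]
      = ∑ j ∈ Finset.range (n + 1), CMB.pmfReal n p ν j * ((j : ℝ) - μ) ^ 2 := by
    rw [variance_eq_integral hYr, ← hμ, hint fun k => ((k : ℝ) - μ) ^ 2,
      CMB.integral_cmbMeasure hp0 hp1]
  have hexp : ∀ θ : ℝ, Integrable (fun ω => Real.exp (θ * (Y ω : ℝ))) P := fun θ => by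
    have := CMB.integrable_cmbMeasure (n := n) (p := p) (ν := ν) fun k => Real.exp (θ * (k : ℝ))
    rw [← hY.map_eq] at this
    exact this.comp_aemeasurable hYm
  -- Chernoff's bound is optimized at exponent `log x` with `x = 1 ± t / μ`; `t < μ` keeps `x`
  -- positive in the lower tail.
  have hmgf : ∀ x : ℝ, 0 < x → mgf (fun ω => (Y ω : ℝ)) P (Real.log x)
      ≤ Real.exp (μ * (x - 1)) := fun x hx => by
    have h1 := CMB.integral_exp_le hp0 hp1 hν hμ0 hm (Real.log x)
    rw [← hint fun k => Real.exp (Real.log x * (k : ℝ)), Real.exp_log hx] at h1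
    exact h1
  refine ⟨?_, ⟨?_, ?_⟩, ?_, fun t ht => ?_, fun t ht htμ => ?_, ?_, ?_⟩
  · rw [hY.map_eq, hvar]
    exact CMB.dTV_poissonMeasure_le hp0 hp1 hν hμ0 hm
  · rw [hY.map_eq, hvar]
    exact CMB.le_poincareConst hp0 hp1 hm
  · rw [hY.map_eq]
    exact CMB.poincareConst_le hp0 hp1 hν hm
  · rw [hY.map_eq]
    exact CMB.cxLE_poissonMeasure hp0 hp1 hν hμ0 hm
  · have hx : 1 ≤ 1 + t / μ := le_add_of_nonneg_right (by positivity)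
    have hx0 : 0 < 1 + t / μ := by linarith
    refine (measure_ge_le_exp_mul_mgf (μ + t) (Real.log_nonneg hx) (hexp _)).trans ?_
    have h1 := hmgf _ hx0
    rw [show μ * (1 + t / μ - 1) = t by field_simp; ring] at h1
    rw [Real.rpow_def_of_pos hx0, mul_comm, neg_mul, mul_neg]
    gcongr
  · have ht1 : t / μ < 1 := (div_lt_one hμ0).2 htμ
    have hx0 : 0 < 1 - t / μ := by linarith
    have hx : 1 - t / μ ≤ 1 := sub_le_self _ (by positivity)
    refine (measure_le_le_exp_mul_mgf (μ - t) (Real.log_nonpos hx0.le hx) (hexp _)).trans ?_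
    have h1 := hmgf _ hx0
    rw [show μ * (1 - t / μ - 1) = -t by field_simp; ring] at h1
    rw [Real.rpow_def_of_pos hx0, mul_comm, neg_mul, ← neg_sub μ t, mul_neg]
    gcongr
  · rw [hY.map_eq]
    exact CMB.stLE_powerBias_one hn hp0 hp1 hν
  · intro f hf _ _
    rw [integral_map (hYm.add_const 1) .of_discrete, hint fun k => f ((k + 1 : ℕ) : ℝ), hY.map_eq]
    exact CMB.integral_powerBias_le_integral_succ (f := fun k : ℕ => f k) hn hp0 hp1 hν
      (hf.comp Nat.mono_cast)
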